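/- Let $m\ge 2$, $n\ge 2$, $N=\{1,\dots,n\}$, and let $\mathcal A=(a_{i_1i_2\cdots i_m})$ be a complex tensor of order $m$ and dimension $n$ ($i_1,\dots,i_m\in N$). For $i,j\in N$ with $j\ne i$ put $$r_i(\mathcal A)=\sum_{(i_2,\dots,i_m)\neq(i,\dots,i)}|a_{ii_2\cdots i_m}|,\qquad r_i^j(\mathcal A)=\sum_{(i_2,\dots,i_m)\neq(i,\dots,i),\,(j,\dots,j)}|a_{ii_2\cdots i_m}|=r_i(\mathcal A)-|a_{ij\cdots j}|.$$ The determinant $\det(\mathcal A)$ is the resultant of the ordered system of $n$ forms of degree $m-1$ in $x_1,\dots,x_n$ $$(\mathcal A x^{m-1})_i=\sum_{i_2,\dots,i_m\in N}a_{ii_2\cdots i_m}x_{i_2}\cdots x_{i_m},\qquad i\in N,$$ where the resultant is normalized to be $1$ at the system $x_1^{m-1},\dots,x_n^{m-1}$. Suppose that for all $i,j\in N$ with $j\neq i$, either $$\left(|a_{i\cdots i}|-r_i^j(\mathcal A)\right)|a_{j\cdots j}|>|a_{ij\cdots j}|\,r_j(\mathcal A),$$ or $$\left(|a_{i\cdots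 i}|+r_i^p(\mathcal A)\right)|a_{p\cdots p}|<|a_{ip\cdots p}|\left(2|a_{pi\cdots i}|-r_p(\mathcal A)\right)\quad\text{for some }p\in N,\ p\neq i.$$ Then $\det(\mathcal A)\neq 0$. -/

import Mathlib

noncomputable section

namespace TensorDet

open MvPolynomial

/-! ## The multivariate resultant of `n` forms in `n` variables

The resultant is built as in classical elimination theory (Hurwitz, van der Waerden, Jouanolou):
the inertia forms of the universal system of degrees `d 1, …, d n` form a principal ideal of the
ring of integer polynomials in the coefficients, and the resultant is the generator of this ideal
whose value at the system `x₁ ^ d 1, …, xₙ ^ d n` is `1`. -/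

/-- The exponents of the monomials of total degree `e` in `n` variables. -/
abbrev Expo (n e : ℕ) : Type :=
  {α : Fin n →₀ ℕ // α ∈ (Finset.univ : Finset (Fin n)).finsuppAntidiag e}

/-- The indices `(i, α)` of the indeterminate coefficients `u_{i, α}`, with `|α| = d i`. -/
abbrev CoeffIdx {n : ℕ} (d : Fin n → ℕ) : Type := Σ i : Fin n, Expo n (d i)

/-- The ring `ℤ[u_{i, α}]` of integer polynomials in the indeterminate coefficients. -/
abbrev CoeffRing {n : ℕ} (d : Fin n → ℕ) : Type := MvPolynomial (CoeffIdx d) ℤ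

/-- The universal form `∑_{|α| = d i} u_{i, α} x ^ α` of degree `d i`. -/
def universalForm {n : ℕ} (d : Fin n → ℕ) (i : Fin n) :
    MvPolynomial (Fin n) (CoeffRing d) :=
  ∑ α : Expo n (d i), monomial α.1 (X ⟨i, α⟩ : CoeffRing d)

/-- The ideal of inertia forms (of degree `0` in `x`): all `R ∈ ℤ[u]` such that, for some `k`,
every `x_j ^ k * R` lies in the ideal generated by the universal forms. -/
def inertiaIdeal {n : ℕ} (d : Fin n → ℕ) : Ideal (CoeffRing d) where
  carrier := {R | ∃ k : ℕ, ∀ j : Fin n,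
    X j ^ k * C R ∈ Ideal.span (Set.range (universalForm d))}
  zero_mem' := ⟨0, fun j => by simp⟩
  add_mem' := by
    rintro R S ⟨k, hk⟩ ⟨l, hl⟩
    refine ⟨k + l, fun j => ?_⟩
    have h1 := Ideal.mul_mem_left _ (X j ^ l) (hk j)
    have h2 := Ideal.mul_mem_left _ (X j ^ k) (hl j)
    have h := Ideal.add_mem _ h1 h2
    have e : (X j ^ (k + l) * C (R + S) : MvPolynomial (Fin n) (CoeffRing d)) =
        X j ^ l * (X j ^ k * C R) + X j ^ k * (X j ^ l * C S) := by
      rw [map_add]; ring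
    rw [e]; exact h
  smul_mem' := by
    rintro S R ⟨k, hk⟩
    refine ⟨k, fun j => ?_⟩
    have h := Ideal.mul_mem_left _ (C S) (hk j)
    have e : (X j ^ k * C (S • R) : MvPolynomial (Fin n) (CoeffRing d)) =
        C S * (X j ^ k * C R) := by
      rw [smul_eq_mul, map_mul]; ring
    rw [e]; exact h

/-- Every ideal of a Noetherian unique factorization domain has a greatest common divisor. -/
theorem exists_ideal_gcd {R : Type*} [CommRing R] [IsDomain R] [IsNoetherianRing R]
    [UniqueFactorizationMonoid R] (I : Ideal R) :
    ∃ g : R, ∀ D : R, D ∣ g ↔ ∀ a ∈ I, D ∣ a := by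
  classical
  obtain ⟨inst⟩ : Nonempty (NormalizedGCDMonoid R) := inferInstance
  obtain ⟨s, hs⟩ := IsNoetherian.noetherian I
  refine ⟨s.gcd id, fun D => ?_⟩
  rw [Finset.dvd_gcd_iff]
  constructor
  · intro h a ha
    have hle : I ≤ Ideal.span {D} := by
      rw [← hs]
      refine Submodule.span_le.2 fun b hb => ?_
      exact Ideal.mem_span_singleton.2 (h b hb)
    exact Ideal.mem_span_singleton.1 (hle ha)
  · intro h b hb
    exact h b (hs ▸ Submodule.subset_span hb)

/-- A greatest common divisor of the ideal of inertia forms. As this ideal is principal (for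
`n ≥ 1` and positive degrees), this is
a generator of it; it is determined up to sign. -/
def preResultant {n : ℕ} (d : Fin n → ℕ) : CoeffRing d :=
  Classical.choose (exists_ideal_gcd (inertiaIdeal d))

/-- The value of `R ∈ ℤ[u]` at the coefficients of the system `G₁, …, Gₙ`, where the `Gᵢ` are
forms of degree `d i` over a commutative ring `K`. -/
def evalAt {n : ℕ} (d : Fin n → ℕ) {K : Type*} [CommRing K] (R : CoeffRing d)
    (G : Fin n → MvPolynomial (Fin n) K) : K :=
  aeval (fun c : CoeffIdx d => (G c.1).coeff c.2.1) R

/-- The universal resultant of degrees `d 1, …, d n`. The factor is `1` or `-1`; it makes the value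
at `x₁ ^ d 1, …, xₙ ^ d n` equal to `1`. -/
def universalResultant {n : ℕ} (d : Fin n → ℕ) : CoeffRing d :=
  C (evalAt d (preResultant d) (fun i => (X i ^ d i : MvPolynomial (Fin n) ℤ))) * preResultant d

/-- The resultant of an ordered system `G₁, …, Gₙ` of forms of degrees `d 1, …, d n` in `n`
variables. -/
def resultant {n : ℕ} (d : Fin n → ℕ) {K : Type*} [CommRing K]
    (G : Fin n → MvPolynomial (Fin n) K) : K :=
  evalAt d (universalResultant d) G

/-! ## Tensors -/

/-- Complex tensors of order `m ≥ 1` and dimension `n`. The entry with indices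
`i₁, i₂, …, i_m` is `A i₁ t`, where `t` is the tuple `(i₂, …, i_m)`. In particular
`A i (fun _ => j)` is the entry `a_{i j ⋯ j}`. -/
abbrev Tensor (m n : ℕ) : Type := Fin n → (Fin (m - 1) → Fin n) → ℂ

/-- The form `(A x ^ (m - 1))_i = ∑ a_{i i₂ ⋯ i_m} x_{i₂} ⋯ x_{i_m}`, of degree `m - 1`. -/
def Tensor.form {m n : ℕ} (A : Tensor m n) (i : Fin n) : MvPolynomial (Fin n) ℂ :=
  ∑ t : Fin (m - 1) → Fin n, C (A i t) * ∏ k, X (t k)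

/-- The determinant of a tensor: the resultant of the ordered system `A x ^ (m - 1) = 0`. -/
def Tensor.det {m n : ℕ} (A : Tensor m n) : ℂ :=
  resultant (fun _ => m - 1) A.form

/-- `r_i(A)`: the sum of the moduli of all `a_{i i₂ ⋯ i_m}` with `(i₂, …, i_m) ≠ (i, …, i)`. -/
def Tensor.r {m n : ℕ} (A : Tensor m n) (i : Fin n) : ℝ :=
  ∑ t : Fin (m - 1) → Fin n with t ≠ (fun _ => i), ‖A i t‖

/-- `r_i^j(A)`: the sum of the moduli of all `a_{i i₂ ⋯ i_m}` with `(i₂, …, i_m)` different from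
`(i, …, i)` and from `(j, …, j)`. -/
def Tensor.rr {m n : ℕ} (A : Tensor m n) (i j : Fin n) : ℝ :=
  ∑ t : Fin (m - 1) → Fin n with t ≠ (fun _ => i) ∧ t ≠ (fun _ => j), ‖A i t‖

end TensorDet

end

namespace TensorDet

open MvPolynomial

/-! ### Elimination theory: no non-trivial zero implies a non-zero resultant. -/

section Elimination

variable {n : ℕ} {d : Fin n → ℕ}

/-! The determinant can vanish only if the forms have a common zero `x ≠ 0`. If there is none, the
Nullstellensatz puts all monomials of some degree into the ideal of the system, so a maximal minor
of its Macaulay matrix is non-zero. By Cramer's rule the same minor of the universal system is an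
inertia form; the gcd divides it, hence does not vanish either (`exists_inertia_ne_zero`,
`resultant_ne_zero`). A non-trivial zero is excluded by comparing two equations: that of an index
`i` with `|x_i|` maximal, and that of one other index `p`. The remaining terms are bounded by powers
of `|x_i|` (`Tensor.norm_add_le`), and eliminating `|x_p| ^ (m - 1)` contradicts either alternative
of the hypothesis. -/

theorem universalForm_isHomogeneous (i : Fin n) : (universalForm d i).IsHomogeneous (d i) := by
  refine IsHomogeneous.sum _ _ _ fun α _ => isHomogeneous_monomial _ ?_
  have h := (Finset.mem_finsuppAntidiag.1 α.2).1
  rw [Finsupp.degree_eq_sum]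
  exact h

/-- Specializing the coefficients of the universal form to those of a form gives this form. -/
theorem map_universalForm {K : Type*} [CommRing K] {F : Fin n → MvPolynomial (Fin n) K}
    {i : Fin n} (hF : (F i).IsHomogeneous (d i)) :
    map (aeval (R := ℤ) (fun c : CoeffIdx d => (F c.1).coeff c.2.1)).toRingHom
      (universalForm d i) = F i := by
  classical
  ext α
  have key : ∀ x : Expo n (d i),
      coeff α (monomial x.1 (coeff x.1 (F i))) = if x.1 = α then coeff α (F i) else 0 := by
    intro x
    rw [coeff_monomial]
    split_ifs with h
    · rw [h]
    · rfl
  simp only [universalForm, map_sum, map_monomial, AlgHom.toRingHom_eq_coe, RingHom.coe_coe,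
    aeval_X, coeff_sum, key]
  by_cases hα : α ∈ (Finset.univ : Finset (Fin n)).finsuppAntidiag (d i)
  · rw [Finset.sum_eq_single (⟨α, hα⟩ : Expo n (d i))]
    · simp
    · intro x _ hx
      exact if_neg fun h => hx (Subtype.ext h)
    · simp
  · rw [Finset.sum_eq_zero fun x _ => if_neg fun h => hα (by rw [← h]; exact x.2)]
    refine (hF.coeff_eq_zero fun h => hα ?_).symm
    rw [Finset.mem_finsuppAntidiag]
    exact ⟨by rw [← h, Finsupp.degree_eq_sum], Finset.subset_univ _⟩

/-- The vector of the coefficients of degree `D`. -/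
noncomputable def coeffVec {K : Type*} [CommRing K] (D : ℕ) :
    MvPolynomial (Fin n) K →ₗ[K] (Expo n D → K) :=
  LinearMap.pi fun α => lcoeff K α.1

theorem coeffVec_apply {K : Type*} [CommRing K] (D : ℕ) (p : MvPolynomial (Fin n) K)
    (α : Expo n D) : coeffVec D p α = p.coeff α.1 := rfl

theorem degree_expo {D : ℕ} (α : Expo n D) : α.1.degree = D := by
  rw [Finsupp.degree_eq_sum]
  exact (Finset.mem_finsuppAntidiag.1 α.2).1

/-- A form is the sum of its coefficients times monomials of its degree. -/
theorem eq_sum_of_isHomogeneous {K : Type*} [CommRing K] {D : ℕ} {p : MvPolynomial (Fin n) K}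
    (hp : p.IsHomogeneous D) : p = ∑ α : Expo n D, C (p.coeff α.1) * monomial α.1 1 := by
  classical
  ext β
  simp only [coeff_sum, coeff_C_mul, coeff_monomial, mul_ite, mul_one, mul_zero]
  by_cases hβ : β ∈ (Finset.univ : Finset (Fin n)).finsuppAntidiag D
  · rw [Finset.sum_eq_single (⟨β, hβ⟩ : Expo n D)]
    · simp
    · intro x _ hx
      exact if_neg fun h => hx (Subtype.ext h)
    · simp
  · rw [Finset.sum_eq_zero fun x _ => if_neg fun h => hβ (by rw [← h]; exact x.2)]
    refine hp.coeff_eq_zero fun h => hβ ?_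
    rw [Finset.mem_finsuppAntidiag]
    exact ⟨by rw [← h, Finsupp.degree_eq_sum], Finset.subset_univ _⟩

/-- The indices of the products of monomials with the forms of the system that have degree `D`. -/
abbrev MacaulayIdx (d : Fin n → ℕ) (D : ℕ) : Type :=
  {c : Fin n × (Fin n →₀ ℕ) // c.2.degree + d c.1 = D}

/-- The products of degree `D` of monomials with the forms of a system. -/
noncomputable def macaulayRow {K : Type*} [CommRing K] (F : Fin n → MvPolynomial (Fin n) K) {D : ℕ}
    (c : MacaulayIdx d D) : MvPolynomial (Fin n) K :=
  monomial c.1.2 1 * F c.1.1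

theorem macaulayRow_isHomogeneous {K : Type*} [CommRing K] {F : Fin n → MvPolynomial (Fin n) K}
    (hF : ∀ i, (F i).IsHomogeneous (d i)) {D : ℕ} (c : MacaulayIdx d D) :
    (macaulayRow F c).IsHomogeneous D := by
  have h := (isHomogeneous_monomial (1 : K) (rfl : c.1.2.degree = _)).mul (hF c.1.1)
  rwa [c.2] at h

/-- The part of degree `D` of the ideal generated by forms is spanned by the products of degree
`D` of monomials with these forms. -/
theorem coeffVec_mem_span {K : Type*} [CommRing K] {F : Fin n → MvPolynomial (Fin n) K}
    (hF : ∀ i, (F i).IsHomogeneous (d i)) (D : ℕ) {p : MvPolynomial (Fin n) K}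
    (hp : p ∈ Ideal.span (Set.range F)) :
    coeffVec D p ∈
      Submodule.span K (Set.range fun c : MacaulayIdx d D => coeffVec D (macaulayRow F c)) := by
  obtain ⟨q, rfl⟩ := (Ideal.mem_span_range_iff_exists_fun).1 hp
  rw [map_sum]
  refine Submodule.sum_mem _ fun i _ => ?_
  induction q i using MvPolynomial.induction_on' with
  | add p q hp hq =>
    rw [add_mul, map_add]
    exact Submodule.add_mem _ hp hq
  | monomial β c =>
    have e : monomial β c * F i = c • (monomial β 1 * F i) := by
      rw [← smul_mul_assoc, smul_monomial, smul_eq_mul, mul_one]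
    rw [e, map_smul]
    refine Submodule.smul_mem _ _ ?_
    by_cases h : β.degree + d i = D
    · exact Submodule.subset_span ⟨⟨(i, β), h⟩, rfl⟩
    · have h0 : coeffVec D (monomial β 1 * F i) = 0 := by
        ext α
        have hh := (isHomogeneous_monomial (1 : K) (rfl : β.degree = _)).mul (hF i)
        exact hh.coeff_eq_zero fun h' => h (by rw [← h', degree_expo])
      rw [h0]
      exact Submodule.zero_mem _

/-- A spanning family of vectors of a coordinate space has an invertible square submatrix. -/
theorem exists_det_ne_zero_of_span_eq_top {K ι J : Type*} [Field K] [Fintype J] [DecidableEq J]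
    (v : ι → J → K) (hv : Submodule.span K (Set.range v) = ⊤) :
    ∃ f : J → ι, (Matrix.of fun j => v (f j)).det ≠ 0 := by
  obtain ⟨κ, a, -, hspan, hli⟩ := exists_linearIndependent' K v
  let b := Module.Basis.mk hli (by rw [hspan, hv])
  let e := b.indexEquiv (Pi.basisFun K J)
  refine ⟨fun j => a (e.symm j), ?_⟩
  have h : LinearIndependent K (Matrix.of fun j => v (a (e.symm j))).row :=
    hli.comp e.symm e.symm.injective
  rw [Matrix.linearIndependent_rows_iff_isUnit, Matrix.isUnit_iff_isUnit_det] at h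
  exact h.ne_zero

/-- If every monomial of degree `D` lies in the ideal of a system of forms over a field, then some
inertia form does not vanish at this system. -/
theorem exists_inertia_ne_zero {K : Type*} [Field K] {F : Fin n → MvPolynomial (Fin n) K}
    (hF : ∀ i, (F i).IsHomogeneous (d i)) (D : ℕ)
    (hD : ∀ α : Expo n D, monomial α.1 (1 : K) ∈ Ideal.span (Set.range F)) :
    ∃ R ∈ inertiaIdeal d, evalAt d R F ≠ 0 := by
  classical
  have htop : Submodule.span K
      (Set.range fun c : MacaulayIdx d D => coeffVec D (macaulayRow F c)) = ⊤ := by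
    rw [eq_top_iff, ← (Pi.basisFun K (Expo n D)).span_eq, Submodule.span_le]
    rintro _ ⟨α, rfl⟩
    have e : Pi.basisFun K (Expo n D) α = coeffVec D (monomial α.1 1) := by
      ext β
      rw [coeffVec_apply, coeff_monomial, Pi.basisFun_apply, Pi.single_apply]
      exact if_congr (by rw [eq_comm, Subtype.ext_iff]) rfl rfl
    rw [e]
    exact coeffVec_mem_span hF D (hD α)
  obtain ⟨f, hf⟩ := exists_det_ne_zero_of_span_eq_top _ htop
  -- The rows that are independent for `F`, taken for the universal system; specializing the
  -- coefficients recovers the invertible matrix.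
  let N : Matrix (Expo n D) (Expo n D) (CoeffRing d) :=
    Matrix.of fun j => coeffVec D (macaulayRow (universalForm d) (f j))
  have hrow : ∀ j, macaulayRow (universalForm d) (f j) =
      ∑ α : Expo n D, C (N j α) * monomial α.1 1 := fun j =>
    eq_sum_of_isHomogeneous (macaulayRow_isHomogeneous universalForm_isHomogeneous (f j))
  have hmem : ∀ α : Expo n D, monomial α.1 1 * C N.det ∈
      Ideal.span (Set.range (universalForm d)) := by
    intro α
    -- Cramer's rule: the adjugate writes `det N` times each monomial as a combination of the rows.
    have e : monomial α.1 1 * C N.det =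
        ∑ j, C (N.adjugate α j) * macaulayRow (universalForm d) (f j) := by
      simp_rw [hrow, Finset.mul_sum]
      rw [Finset.sum_comm]
      simp_rw [← mul_assoc, ← C_mul, ← Finset.sum_mul, ← map_sum, ← Matrix.mul_apply,
        Matrix.adjugate_mul, Matrix.smul_apply, Matrix.one_apply]
      rw [Finset.sum_eq_single α]
      · simp [mul_comm]
      · intro β _ hβ
        simp [hβ.symm]
      · simp
    rw [e]
    refine Ideal.sum_mem _ fun j _ => Ideal.mul_mem_left _ _ (Ideal.mul_mem_left _ _ ?_)
    exact Ideal.subset_span ⟨_, rfl⟩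
  refine ⟨N.det, ⟨D, fun j => ?_⟩, ?_⟩
  · have hj : Finsupp.single j D ∈ (Finset.univ : Finset (Fin n)).finsuppAntidiag D := by
      rw [Finset.mem_finsuppAntidiag]
      exact ⟨by rw [← Finsupp.degree_eq_sum, Finsupp.degree_single], Finset.subset_univ _⟩
    have h := hmem ⟨_, hj⟩
    rwa [← X_pow_eq_monomial] at h
  · convert hf using 1
    let ev := (aeval (R := ℤ) (fun c : CoeffIdx d => (F c.1).coeff c.2.1)).toRingHom
    change ev N.det = _
    rw [RingHom.map_det]
    congr 1
    ext j α
    change ev (coeff α.1 (macaulayRow (universalForm d) (f j))) =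
      coeff α.1 (macaulayRow F (f j))
    rw [← coeff_map, macaulayRow, map_mul, map_monomial, map_one, map_universalForm (hF _)]
    rfl

/-- A system of forms over an algebraically closed field without non-trivial zeros is not a zero
of every inertia form. -/
theorem exists_inertia_ne_zero_of_no_zero {K : Type*} [Field K] [IsAlgClosed K]
    {F : Fin n → MvPolynomial (Fin n) K}
    (hF : ∀ i, (F i).IsHomogeneous (d i))
    (h0 : ∀ x : Fin n → K, (∀ i, eval x (F i) = 0) → x = 0) :
    ∃ R ∈ inertiaIdeal d, evalAt d R F ≠ 0 := by
  -- Nullstellensatz: the zero locus lies in `{0}`, where each variable vanishes.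
  have hrad : ∀ j, X j ∈ (Ideal.span (Set.range F)).radical := by
    intro j
    rw [← vanishingIdeal_zeroLocus_eq_radical (K := K), mem_vanishingIdeal_iff]
    intro x hx
    rw [h0 x fun i => ?_]
    · simp
    · have := (mem_zeroLocus_iff.1 hx) (F i) (Ideal.subset_span ⟨i, rfl⟩)
      rwa [aeval_eq_eval] at this
  choose k hk using hrad
  let k' := ∑ j, k j
  -- Pigeonhole: in this degree some exponent is at least `k'`, hence at least `k j`.
  refine exists_inertia_ne_zero hF (n * k' + 1) fun α => ?_
  obtain ⟨j, hj⟩ : ∃ j, k' ≤ α.1 j := by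
    by_contra! h
    have hle : ∑ j, α.1 j ≤ ∑ _j : Fin n, k' := Finset.sum_le_sum fun j _ => (h j).le
    have hs : ∑ j, α.1 j = n * k' + 1 := (Finset.mem_finsuppAntidiag.1 α.2).1
    simp [hs] at hle
  have hkj : Finsupp.single j (k j) ≤ α.1 := by
    rw [Finsupp.single_le_iff]
    exact (Finset.single_le_sum (fun _ _ => Nat.zero_le _) (Finset.mem_univ j)).trans hj
  have e : monomial α.1 (1 : K) = monomial (α.1 - Finsupp.single j (k j)) 1 * X j ^ k j := by
    rw [X_pow_eq_monomial, monomial_mul, tsub_add_cancel_of_le hkj, one_mul]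
  rw [e]
  exact Ideal.mul_mem_left _ _ (hk j)

theorem preResultant_dvd {R : CoeffRing d} (hR : R ∈ inertiaIdeal d) : preResultant d ∣ R :=
  (Classical.choose_spec (exists_ideal_gcd (inertiaIdeal d)) (preResultant d)).1 dvd_rfl R hR

theorem evalAt_preResultant_ne_zero {K : Type*} [Field K] [IsAlgClosed K]
    {F : Fin n → MvPolynomial (Fin n) K}
    (hF : ∀ i, (F i).IsHomogeneous (d i))
    (h0 : ∀ x : Fin n → K, (∀ i, eval x (F i) = 0) → x = 0) :
    evalAt d (preResultant d) F ≠ 0 := by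
  obtain ⟨R, hR, hRF⟩ := exists_inertia_ne_zero_of_no_zero hF h0
  obtain ⟨S, rfl⟩ := preResultant_dvd hR
  rw [evalAt, map_mul] at hRF
  exact left_ne_zero_of_mul hRF

/-- Allows the integer normalizing factor of the resultant to be tested for non-vanishing over `K`,
without knowing that it is `1` or `-1`. -/
theorem evalAt_X_pow (R : CoeffRing d) (K : Type*) [CommRing K] :
    ((evalAt d R fun i => (X i ^ d i : MvPolynomial (Fin n) ℤ) : ℤ) : K) =
      evalAt d R fun i => (X i ^ d i : MvPolynomial (Fin n) K) := by
  classical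
  rw [evalAt, evalAt, ← eq_intCast (Int.castRingHom K), aeval_def, aeval_def, hom_eval₂,
    RingHom.ext_int ((Int.castRingHom K).comp (algebraMap ℤ ℤ)) (algebraMap ℤ K)]
  congr 1
  funext c
  simp only [coeff_X_pow]
  split_ifs <;> simp

/-- The resultant of a system of forms of positive degrees over an algebraically closed field
without non-trivial zeros does not vanish. -/
theorem resultant_ne_zero {K : Type*} [Field K] [IsAlgClosed K]
    (hd : ∀ i, d i ≠ 0) {F : Fin n → MvPolynomial (Fin n) K}
    (hF : ∀ i, (F i).IsHomogeneous (d i))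
    (h0 : ∀ x : Fin n → K, (∀ i, eval x (F i) = 0) → x = 0) :
    resultant d F ≠ 0 := by
  -- The pure powers have only the trivial zero because the degrees are positive.
  have h1 : evalAt d (preResultant d) (fun i => (X i ^ d i : MvPolynomial (Fin n) K)) ≠ 0 := by
    refine evalAt_preResultant_ne_zero (fun i => isHomogeneous_X_pow i (d i)) fun x hx => ?_
    funext i
    have := hx i
    rw [map_pow, eval_X] at this
    exact pow_eq_zero_iff (hd i) |>.1 this
  have h2 := evalAt_preResultant_ne_zero hF h0
  rw [← evalAt_X_pow] at h1
  rw [resultant, universalResultant, evalAt, map_mul, algHom_C]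
  refine mul_ne_zero ?_ h2
  simpa using h1

end Elimination

/-! ### Estimates for a zero of a tensor's forms. -/

section Tensors

variable {m n : ℕ} (A : Tensor m n)

theorem Tensor.form_isHomogeneous (i : Fin n) : (A.form i).IsHomogeneous (m - 1) := by
  refine IsHomogeneous.sum _ _ _ fun t _ => ?_
  have h := (isHomogeneous_C (Fin n) (A i t)).mul
    (IsHomogeneous.prod Finset.univ (fun k => X (t k)) (fun _ => 1)
      fun k _ => isHomogeneous_X ℂ (t k))
  simpa using h

theorem Tensor.eval_form (i : Fin n) (x : Fin n → ℂ) :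
    eval x (A.form i) = ∑ t : Fin (m - 1) → Fin n, A i t * ∏ k, x (t k) := by
  simp [Tensor.form, map_sum, map_prod]

theorem const_ne_const (hm : 2 ≤ m) {i j : Fin n} (hij : j ≠ i) :
    (fun _ : Fin (m - 1) => j) ≠ fun _ => i :=
  fun h => hij (congrFun h ⟨0, by omega⟩)

theorem Tensor.r_eq (hm : 2 ≤ m) {i j : Fin n} (hij : j ≠ i) :
    A.r i = ‖A i fun _ => j‖ + A.rr i j := by
  classical
  have hmem : (fun _ => j) ∈ Finset.univ.filter fun t : Fin (m - 1) → Fin n => t ≠ fun _ => i := by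
    simpa using const_ne_const hm hij
  rw [Tensor.r, ← Finset.add_sum_erase _ _ hmem, Tensor.rr]
  congr 2
  ext t
  simp [and_comm]

/-- At a zero of the `i`-th form, the two monomials `x_i ^ (m - 1)` and `x_j ^ (m - 1)` are, up to
the remaining terms, opposite. -/
theorem Tensor.norm_add_le (hm : 2 ≤ m) {i j : Fin n} (hij : j ≠ i) {x : Fin n → ℂ} {M : ℝ}
    (hM : ∀ k, ‖x k‖ ≤ M) (hx : eval x (A.form i) = 0) :
    ‖(A i fun _ => i) * x i ^ (m - 1) + (A i fun _ => j) * x j ^ (m - 1)‖ ≤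
      A.rr i j * M ^ (m - 1) := by
  classical
  rw [A.eval_form, ← Finset.add_sum_erase _ _ (Finset.mem_univ fun _ => i),
    ← Finset.add_sum_erase _ _ (show (fun _ => j) ∈ Finset.univ.erase fun _ => i by
      simpa using const_ne_const hm hij), ← add_assoc] at hx
  simp only [Finset.prod_const, Finset.card_univ, Fintype.card_fin] at hx
  rw [eq_neg_of_add_eq_zero_left hx, norm_neg, Tensor.rr, Finset.sum_mul]
  refine (norm_sum_le _ _).trans ?_
  have e : (Finset.univ.erase fun _ => i).erase (fun _ => j) =
      Finset.univ.filter fun t : Fin (m - 1) → Fin n => t ≠ (fun _ => i) ∧ t ≠ fun _ => j := by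
    ext t
    simp [and_comm]
  rw [e]
  refine Finset.sum_le_sum fun t _ => ?_
  rw [norm_mul, norm_prod]
  refine mul_le_mul_of_nonneg_left ?_ (norm_nonneg _)
  refine (Finset.prod_le_prod (fun _ _ => norm_nonneg _) fun k _ => hM (t k)).trans ?_
  simp

end Tensors

end TensorDet

theorem mainTheorem4 (m n : ℕ) (hm : 2 ≤ m) (hn : 2 ≤ n) (A : TensorDet.Tensor m n)
    (hA : ∀ i j : Fin n, j ≠ i →
      (‖A i (fun _ => i)‖ - A.rr i j) * ‖A j (fun _ => j)‖ > ‖A i (fun _ => j)‖ * A.r j ∨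
      ∃ p : Fin n, p ≠ i ∧
        (‖A i (fun _ => i)‖ + A.rr i p) * ‖A p (fun _ => p)‖ <
          ‖A i (fun _ => p)‖ * (2 * ‖A p (fun _ => i)‖ - A.r p)) :
    A.det ≠ 0 := by
  refine TensorDet.resultant_ne_zero (fun _ => by omega) A.form_isHomogeneous fun x hx => ?_
  have : Nonempty (Fin n) := ⟨⟨0, by omega⟩⟩
  have : Nontrivial (Fin n) := Fin.nontrivial_iff_two_le.2 hn
  obtain ⟨i, hi⟩ := Finite.exists_max fun k => ‖x k‖
  obtain ⟨j, hj⟩ := exists_ne i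
  by_contra hx0
  have hxi : 0 < ‖x i‖ := by
    obtain ⟨k, hk⟩ := Function.ne_iff.1 hx0
    exact (norm_pos_iff.2 hk).trans_le (hi k)
  have hpos : 0 < ‖x i‖ ^ (m - 1) := pow_pos hxi _
  have row : ∀ p, p ≠ i →
      |‖A i fun _ => i‖ * ‖x i‖ ^ (m - 1) - ‖A i fun _ => p‖ * ‖x p‖ ^ (m - 1)| ≤
        A.rr i p * ‖x i‖ ^ (m - 1) ∧
      |‖A p fun _ => p‖ * ‖x p‖ ^ (m - 1) - ‖A p fun _ => i‖ * ‖x i‖ ^ (m - 1)| ≤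
        A.rr p i * ‖x i‖ ^ (m - 1) := by
    intro p hp
    have h1 := A.norm_add_le hm hp hi (hx i)
    have h2 := A.norm_add_le hm hp.symm hi (hx p)
    refine ⟨le_trans ?_ h1, le_trans ?_ h2⟩ <;>
    -- Reverse triangle inequality, for the difference of one term and the negative of the other.
    · rw [← sub_neg_eq_add]
      refine le_trans (le_of_eq ?_) (abs_norm_sub_norm_le _ _)
      simp only [norm_neg, norm_mul, norm_pow]
  rcases hA i j hj with h | ⟨p, hp, h⟩
  · obtain ⟨h1, h2⟩ := row j hj
    rw [A.r_eq hm hj.symm] at h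
    -- These factors make the terms with `‖x j‖ ^ (m - 1)` cancel in the sum of the two upper
    -- bounds.
    have h3 := mul_le_mul_of_nonneg_right (abs_le.1 h1).2 (norm_nonneg (A j fun _ => j))
    have h4 := mul_le_mul_of_nonneg_left (abs_le.1 h2).2 (norm_nonneg (A i fun _ => j))
    have h5 := mul_lt_mul_of_pos_right h hpos
    linarith
  · obtain ⟨h1, h2⟩ := row p hp
    rw [A.r_eq hm hp.symm] at h
    -- The same elimination with the lower bounds; `2|a_{pi⋯i}| - r_p` equals `|a_{pi⋯i}| - r_p^i`.
    have h3 := mul_le_mul_of_nonneg_right (abs_le.1 h1).1 (norm_nonneg (A p fun _ => p))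
    have h4 := mul_le_mul_of_nonneg_left (abs_le.1 h2).1 (norm_nonneg (A i fun _ => p))
    have h5 := mul_lt_mul_of_pos_right h hpos
    linarith
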